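/- Let $A\in\mathbb{R}^{n\times n}$ be stable (all eigenvalues of modulus $<1$), let $b,c^{\mathsf T}\in\mathbb{R}^n$, and let $k\ge 1$ be an integer. **Definitions.** The variation $S(u)\in\{0,1,\dots,\infty\}$ of a real vector or sequence $u$ is the number of sign changes in $u$ after all its zeros have been deleted, with $S(0)=0$. A map $X$ between spaces of real vectors or sequences is $\mathrm{OVD}_m$ if for all $u$ with $S(u)\le m$: (i) $S(Xu)\le S(u)$; and (ii) if $S(Xu)=S(u)$ and $u$ and $Xu$ are both non-zero, then the first non-zero entries of $u$ and of $Xu$ have the same sign. A real matrix is $k$-positive if all its minors of order $1,\dots,k$ are nonnegative (minors of an order exceeding the size of the matrix do not exist and impose no condition). The controllability operator maps a bounded input $u$ on the negative integers to $$\mathcal C(A,b)u=\sum_{t=-\infty}^{-1}A^{-t-1}b\,u(t)\in\mathbb{R}^n,$$ where the input is listed as the sequence $u(-1),u(-2),u(-3),\dots$ (this order decides which entry of $u$ is the first non-zero one). The observability operator maps $x_0\in\mathbb{R}^n$ to the sequence $(\mathcal O(A,c)x_0)(t)=cA^tx_0$, $t=0,1,2,\dots$. For $t\ge1$ put $\mathcal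 C^t(A,b)=\begin{pmatrix}b&Ab&\cdots&A^{t-1}b\end{pmatrix}\in\mathbb{R}^{n\times t}$ and $\mathcal O^t(A,c)=\mathcal C^t(A^{\mathsf T},c^{\mathsf T})^{\mathsf T}\in\mathbb{R}^{t\times n}$. The triple $(A,b,c)$ is internally Hankel $k$-positive if $A$, $\mathcal C(A,b)$ and $\mathcal O(A,c)$ are all $\mathrm{OVD}_{k-1}$. **Claim.** 1. $\mathcal C(A,b)$ is $\mathrm{OVD}_{k-1}$ if and only if $\mathcal C^t(A,b)$ is $k$-positive for all $t\ge k$. 2. $\mathcal O(A,c)$ is $\mathrm{OVD}_{k-1}$ if and only if $\mathcal O^t(A,c)$ is $k$-positive for all $t\ge k$. 3. In particular, $(A,b,c)$ is internally Hankel $k$-positive if and only if $A$, $\mathcal C^t(A,b)$ and $\mathcal O^t(A,c)$ are $k$-positive for all $t\ge k$. -/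

import Mathlib

namespace HankelPositivity

noncomputable section

/-- The variation of a real vector or sequence: the number of sign changes that remain after all
zeros have been deleted. It counts the pairs of successive non-zero entries of opposite sign, and
is `⊤` if there are infinitely many of them. -/
def variation {ι : Type*} [LinearOrder ι] (u : ι → ℝ) : ℕ∞ :=
  {p : ι × ι | p.1 < p.2 ∧ u p.1 * u p.2 < 0 ∧ ∀ l, p.1 < l → l < p.2 → u l = 0}.encard

/-- `i` is the index of the first non-zero entry of `u`. -/
def IsFirstNonzero {ι : Type*} [LinearOrder ι] (u : ι → ℝ) (i : ι) : Prop :=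
  u i ≠ 0 ∧ ∀ l, l < i → u l = 0

/-- The map `X`, with domain `D`, is order-preserving `k`-variation diminishing (`OVD_k`).
The condition on the first non-zero entries is void if `u` or `X u` has no non-zero entry. -/
def IsOVD {ι κ : Type*} [LinearOrder ι] [LinearOrder κ] (k : ℕ) (D : Set (ι → ℝ))
    (X : (ι → ℝ) → (κ → ℝ)) : Prop :=
  ∀ u ∈ D, variation u ≤ (k : ℕ∞) →
    variation (X u) ≤ variation u ∧
    (variation (X u) = variation u →
      ∀ i j, IsFirstNonzero u i → IsFirstNonzero (X u) j →
        SignType.sign (u i) = SignType.sign (X u j))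

/-- The `r`-th multiplicative compound matrix, whose entries are the `r`-minors of `X`. The
`r`-element index sets are given by their increasing enumerations. -/
def compound {m n : ℕ} (X : Matrix (Fin m) (Fin n) ℝ) (r : ℕ) :
    Matrix (Fin r ↪o Fin m) (Fin r ↪o Fin n) ℝ :=
  Matrix.of fun I J => (X.submatrix I J).det

/-- `X` is `k`-positive: all its minors of order `1, …, k` are nonnegative. -/
def IsKPositive {m n : ℕ} (k : ℕ) (X : Matrix (Fin m) (Fin n) ℝ) : Prop :=
  ∀ j, 1 ≤ j → j ≤ k → ∀ I J, 0 ≤ compound X j I J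

/-- `A` is (discrete-time) stable: all its complex eigenvalues have modulus less than one. -/
def IsStable {n : ℕ} (A : Matrix (Fin n) (Fin n) ℝ) : Prop :=
  ∀ z ∈ spectrum ℂ (A.map (algebraMap ℝ ℂ)), ‖z‖ < 1

/-- The truncated controllability matrix `(b  A b  …  A ^ (t - 1) b)`. -/
def conMatrix {n : ℕ} (A : Matrix (Fin n) (Fin n) ℝ) (b : Fin n → ℝ) (t : ℕ) :
    Matrix (Fin n) (Fin t) ℝ :=
  Matrix.of fun i j => ((A ^ (j : ℕ)).mulVec b) i

/-- The truncated observability matrix, with rows `c, c A, …, c A ^ (t - 1)`. -/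
def obsMatrix {n : ℕ} (A : Matrix (Fin n) (Fin n) ℝ) (c : Fin n → ℝ) (t : ℕ) :
    Matrix (Fin t) (Fin n) ℝ :=
  (conMatrix A.transpose c t).transpose

/-- Bounded past inputs. An input on the negative times is listed backwards in time, as
`u(-1), u(-2), …`: the entry with index `τ` is the input at time `-τ - 1`. -/
def pastInputs : Set (ℕ → ℝ) := {u | Memℓp u ⊤}

/-- The controllability operator `u ↦ ∑_{t ≤ -1} A ^ (-t - 1) b u(t)`, where `u τ` is the input at
time `t = -τ - 1`. -/
def conOp {n : ℕ} (A : Matrix (Fin n) (Fin n) ℝ) (b : Fin n → ℝ) (u : ℕ → ℝ) : Fin n → ℝ :=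
  ∑' τ : ℕ, u τ • (A ^ τ).mulVec b

/-- For a stable `A` and a bounded input, the series of the controllability operator converges. -/
theorem summable_conOp {n : ℕ} {A : Matrix (Fin n) (Fin n) ℝ} (hA : IsStable A) (b : Fin n → ℝ)
    {u : ℕ → ℝ} (hu : u ∈ pastInputs) : Summable fun τ : ℕ => u τ • (A ^ τ).mulVec b := by
  let _ : NormedRing (Matrix (Fin n) (Fin n) ℂ) := Matrix.linftyOpNormedRing
  let _ : NormedAlgebra ℂ (Matrix (Fin n) (Fin n) ℂ) := Matrix.linftyOpNormedAlgebra
  set B : Matrix (Fin n) (Fin n) ℂ := A.map (algebraMap ℝ ℂ) with hB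
  have hr : spectralRadius ℂ B < 1 := by
    rcases (spectrum ℂ B).eq_empty_or_nonempty with h | h
    · simp [spectralRadius, h]
    · have := spectrum.spectralRadius_lt_of_forall_lt_of_nonempty (r := 1) h
        (fun z hz => by simpa [← NNReal.coe_lt_coe] using hA z hz)
      simpa using this
  obtain ⟨q, hq, hq1⟩ := exists_between hr
  have hev : ∀ᶠ m : ℕ in Filter.atTop, ‖B ^ m‖ ≤ q.toReal ^ m := by
    have h1 := (spectrum.pow_nnnorm_pow_one_div_tendsto_nhds_spectralRadius B).eventually_lt_const hq
    filter_upwards [h1, Filter.eventually_gt_atTop 0] with m hm hm0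
    have hm0' : (0 : ℝ) < m := by exact_mod_cast hm0
    rw [one_div, ENNReal.rpow_inv_lt_iff hm0', ENNReal.rpow_natCast] at hm
    have := ENNReal.toReal_mono (ENNReal.pow_ne_top (ne_top_of_lt hq1)) hm.le
    simpa using this
  have hq1' : q.toReal < 1 := by
    simpa using (ENNReal.toReal_lt_toReal (ne_top_of_lt hq1) ENNReal.one_ne_top).2 hq1
  obtain ⟨M, hM⟩ := memℓp_infty_iff.1 hu
  have hM' : ∀ τ, |u τ| ≤ M := fun τ => hM ⟨τ, rfl⟩
  have hM0 : 0 ≤ M := (abs_nonneg _).trans (hM' 0)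
  rw [Pi.summable]
  intro i
  refine Summable.of_norm_bounded_eventually_nat
    (g := fun m => M * (q.toReal ^ m * ‖fun j => ((b j : ℝ) : ℂ)‖))
    (((summable_geometric_of_lt_one ENNReal.toReal_nonneg hq1').mul_right _).mul_left _) ?_
  filter_upwards [hev] with m hm
  have h2 : (((A ^ m).mulVec b i : ℝ) : ℂ) = (B ^ m).mulVec (fun j => ((b j : ℝ) : ℂ)) i := by
    have h3 : B ^ m = (A ^ m).map (algebraMap ℝ ℂ) := by
      rw [hB, ← RingHom.mapMatrix_apply, ← RingHom.mapMatrix_apply, map_pow]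
    simp [h3, Matrix.mulVec, dotProduct]
  have h4 : |(A ^ m).mulVec b i| ≤ q.toReal ^ m * ‖fun j => ((b j : ℝ) : ℂ)‖ := by
    have h5 := (norm_le_pi_norm ((B ^ m).mulVec (fun j => ((b j : ℝ) : ℂ))) i).trans
      (Matrix.linfty_opNorm_mulVec (B ^ m) (fun j => ((b j : ℝ) : ℂ)))
    rw [← h2, Complex.norm_real, Real.norm_eq_abs] at h5
    exact h5.trans (mul_le_mul_of_nonneg_right hm (norm_nonneg _))
  simp only [Pi.smul_apply, smul_eq_mul, norm_mul, Real.norm_eq_abs]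
  exact mul_le_mul (hM' m) h4 (abs_nonneg _) hM0

/-- The observability operator `x₀ ↦ (c A ^ t x₀)`, `t = 0, 1, 2, …`. -/
def obsOp {n : ℕ} (A : Matrix (Fin n) (Fin n) ℝ) (c : Fin n → ℝ) (x₀ : Fin n → ℝ) : ℕ → ℝ :=
  fun t => c ⬝ᵥ (A ^ t).mulVec x₀

/-- `(A, b, c)` is internally Hankel `k`-positive (for `k ≥ 1`). -/
def IsInternallyHankelPositive {n : ℕ} (k : ℕ) (A : Matrix (Fin n) (Fin n) ℝ)
    (b c : Fin n → ℝ) : Prop :=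
  IsOVD (k - 1) Set.univ A.mulVec ∧
  IsOVD (k - 1) pastInputs (conOp A b) ∧
  IsOVD (k - 1) Set.univ (obsOp A c)

end

end HankelPositivity

/-! All three equivalences are instances of one statement: for a matrix `K`, possibly with
infinitely many rows or columns and acting by convergent sums, being `OVD_{k-1}` amounts to having
nonnegative minors up to order `k`.

Nonnegative minors suffice (`MinorsNonneg.isOVD`) by `MinorsNonneg.not_alternating`: if `u` starts
positive and has at most `p < k` sign changes, then `K u` cannot alternate `p` times starting with a
negative entry. This excludes a wrong leading sign and, after the first entry of a longer
alternation is dropped, an extra sign change. For the proof, the columns in each sign block of `u`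
are merged (`MinorsNonneg.merge`), which leaves a square matrix acting on a vector of alternating
signs. Cramer's rule rules out a positive determinant; if the determinant is zero, a move along the
kernel kills a coordinate and `p` drops.

Conversely (`IsOVD.minorsNonneg`), a negative minor `det M` of least order is tested on the solution
of `M x = (1, -1, 1, …)`: the OVD property forces `x 0 > 0`, Cramer's rule `x 0 ≤ 0`. -/

namespace HankelPositivity

/-! ### Sign changes and blocks of constant sign -/

section Variation

variable {ι : Type*} [LinearOrder ι]

/-- `t` is an index at which `u` changes sign. -/
def IsSignChange (u : ι → ℝ) (t : ι) : Prop :=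
  ∃ s, s < t ∧ u s * u t < 0 ∧ ∀ l, s < l → l < t → u l = 0

/-- The left end of a sign change is the last non-zero entry before the right end, so the right end
determines the pair. -/
lemma variation_eq_encard (u : ι → ℝ) : variation u = {t | IsSignChange u t}.encard := by
  have himage : {t | IsSignChange u t} = Prod.snd ''
      {p : ι × ι | p.1 < p.2 ∧ u p.1 * u p.2 < 0 ∧ ∀ l, p.1 < l → l < p.2 → u l = 0} := by
    ext t
    simp [IsSignChange]
  rw [himage, Set.InjOn.encard_image]
  · rfl
  · rintro ⟨s, t⟩ ⟨h1, h2, h3⟩ ⟨s', t'⟩ ⟨h1', h2', h3'⟩ (rfl : t = t')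
    simp only at *
    rcases lt_trichotomy s s' with h | h | h
    · simp [h3 s' h h1'] at h2'
    · rw [h]
    · simp [h3' s h h1] at h2

lemma variation_zero_of_forall {u : ι → ℝ} (h : ∀ i, u i = 0) : variation u = 0 := by
  simp [variation, h]

variable [LocallyFiniteOrderBot ι]

open Classical in
/-- The number of sign changes of `u` up to and including the index `i`. -/
noncomputable def signIndex (u : ι → ℝ) (i : ι) : ℕ :=
  ((Finset.Iic i).filter (IsSignChange u)).card

lemma signIndex_mono (u : ι → ℝ) : Monotone (signIndex u) := by
  intro i j hij
  unfold signIndex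
  gcongr

lemma signIndex_le_variation (u : ι → ℝ) (i : ι) : (signIndex u i : ℕ∞) ≤ variation u := by
  rw [variation_eq_encard, signIndex, ← Set.encard_coe_eq_coe_finsetCard]
  apply Set.encard_le_encard
  intro t ht
  simp only [Finset.coe_filter, Set.mem_ofPred_eq] at ht
  exact ht.2

lemma exists_isFirstNonzero {u : ι → ℝ} {i : ι} (hi : u i ≠ 0) : ∃ i₀, IsFirstNonzero u i₀ := by
  classical
  have hne : ((Finset.Iic i).filter fun l => u l ≠ 0).Nonempty := ⟨i, by simp [hi]⟩
  have hm := Finset.min'_mem _ hne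
  simp only [Finset.mem_filter, Finset.mem_Iic] at hm
  refine ⟨_, hm.2, fun l hl => ?_⟩
  by_contra h
  have hle := Finset.min'_le ((Finset.Iic i).filter fun l => u l ≠ 0) l
    (by simp [h, (hl.le.trans hm.1)])
  exact absurd hl hle.not_gt

lemma signIndex_firstNonzero {u : ι → ℝ} {i₀ : ι} (h : IsFirstNonzero u i₀) :
    signIndex u i₀ = 0 := by
  classical
  rw [signIndex, Finset.card_eq_zero, Finset.filter_eq_empty_iff]
  rintro t ht ⟨s, hst, hneg, -⟩
  simp [h.2 s (hst.trans_le (Finset.mem_Iic.1 ht))] at hneg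

/-- Passing to the next non-zero entry raises the sign index by one exactly at a sign change. -/
lemma signIndex_succ {u : ι → ℝ} {s i : ι} (hsi : s < i) (hs : u s ≠ 0) (hi : u i ≠ 0)
    (hz : ∀ l, s < l → l < i → u l = 0) :
    signIndex u i = signIndex u s + if u s * u i < 0 then 1 else 0 := by
  classical
  unfold signIndex
  split_ifs with hneg
  · have hset : (Finset.Iic i).filter (IsSignChange u) =
        insert i ((Finset.Iic s).filter (IsSignChange u)) := by
      ext t
      simp only [Finset.mem_filter, Finset.mem_Iic, Finset.mem_insert]
      constructor
      · rintro ⟨hti, ht⟩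
        rcases hti.eq_or_lt with h | h
        · exact Or.inl h
        · refine Or.inr ⟨?_, ht⟩
          by_contra! h'
          obtain ⟨r, -, hr, -⟩ := ht
          simp [hz t h' h] at hr
      · rintro (rfl | ⟨h, ht⟩)
        · exact ⟨le_rfl, s, hsi, hneg, hz⟩
        · exact ⟨h.trans hsi.le, ht⟩
    rw [hset, Finset.card_insert_of_notMem]
    simp [hsi]
  · rw [add_zero]
    congr 1
    ext t
    simp only [Finset.mem_filter, Finset.mem_Iic]
    refine ⟨?_, fun ⟨h, ht⟩ => ⟨h.trans hsi.le, ht⟩⟩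
    rintro ⟨hti, ht⟩
    refine ⟨?_, ht⟩
    by_contra! h'
    obtain ⟨r, hrt, hr, hrz⟩ := ht
    rcases hti.eq_or_lt with rfl | h
    · rcases lt_trichotomy r s with h1 | h1 | h1
      · exact hs (hrz s h1 hsi)
      · exact hneg (h1 ▸ hr)
      · simp [hz r h1 hrt] at hr
    · simp [hz t h' h] at hr

/-- Induction along the non-zero entries, stepping back to the preceding one. Hence `signIndex`
numbers consecutive blocks on which `u` has a constant weak sign, alternating from block to block.
-/
lemma signIndex_sign {u : ι → ℝ} {i₀ : ι} (h₀ : IsFirstNonzero u i₀) :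
    ∀ i, u i ≠ 0 → 0 < (-1) ^ signIndex u i * (u i₀ * u i) := by
  classical
  suffices H : ∀ n : ℕ, ∀ i, (Finset.Iio i).card = n → u i ≠ 0 →
      0 < (-1) ^ signIndex u i * (u i₀ * u i) from fun i => H _ i rfl
  intro n
  induction n using Nat.strong_induction_on with
  | _ n ih =>
    intro i hn hi
    by_cases hne : ((Finset.Iio i).filter fun l => u l ≠ 0).Nonempty
    · have hm := Finset.max'_mem _ hne
      have hmax := Finset.le_max' ((Finset.Iio i).filter fun l => u l ≠ 0)
      set s := Finset.max' _ hne
      simp only [Finset.mem_filter, Finset.mem_Iio] at hm hmax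
      have hz : ∀ l, s < l → l < i → u l = 0 := fun l h1 h2 => by
        by_contra h
        exact absurd h1 (hmax l ⟨h2, h⟩).not_gt
      have hcard : (Finset.Iio s).card < n := by
        rw [← hn]
        apply Finset.card_lt_card
        rw [Finset.ssubset_iff_of_subset (Finset.Iio_subset_Iio hm.1.le)]
        exact ⟨s, by simpa using hm.1, by simp⟩
      have hs := ih _ hcard s rfl hm.2
      rw [signIndex_succ hm.1 hm.2 hi hz]
      have hsq : 0 < u s * u s := mul_self_pos.2 hm.2
      split_ifs with hneg
      · rw [pow_succ]
        have := mul_pos_of_neg_of_neg (neg_neg_of_pos hs) hneg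
        refine pos_of_mul_pos_left (b := u s * u s) ?_ hsq.le
        linarith
      · have hpos : 0 < u s * u i :=
          lt_of_le_of_ne (not_lt.1 hneg) (mul_ne_zero hm.2 hi).symm
        rw [add_zero]
        refine pos_of_mul_pos_left (b := u s * u s) ?_ hsq.le
        have := mul_pos hs hpos
        linarith
    · have hz : i = i₀ := by
        rw [Finset.not_nonempty_iff_eq_empty, Finset.filter_eq_empty_iff] at hne
        rcases lt_trichotomy i i₀ with h | h | h
        · exact absurd (h₀.2 i h) hi
        · exact h
        · exact absurd h₀.1 (hne (Finset.mem_Iio.2 h))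
      subst hz
      rw [signIndex_firstNonzero h₀]
      simpa using hi

/-- A sequence alternating in sign along `J` has sign index at least `l` at the `l`-th index. -/
lemma le_signIndex_of_alternating {v : ι → ℝ} {j₀ : ι} (h₀ : IsFirstNonzero v j₀) {p : ℕ}
    (J : Fin (p + 1) ↪o ι) (hJ : ∀ l : Fin (p + 1), 0 < (-1) ^ (l : ℕ) * v (J l)) (l : Fin (p + 1)) :
    signIndex v (J 0) + l ≤ signIndex v (J l) := by
  have hne : ∀ l, v (J l) ≠ 0 := fun l h => by simpa [h] using hJ l
  induction l using Fin.induction with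
  | zero => simp
  | succ l ih =>
    have hle := signIndex_mono v (J.monotone (Fin.castSucc_lt_succ (i := l)).le)
    -- Equal sign indices would give entries of equal sign, against the alternation; with
    -- monotonicity the index must rise.
    have hneq : signIndex v (J l.castSucc) ≠ signIndex v (J l.succ) := fun h => by
      have h1 := signIndex_sign h₀ _ (hne l.castSucc)
      have h2 := signIndex_sign h₀ _ (hne l.succ)
      have h3 := hJ l.castSucc
      have h4 := hJ l.succ
      rw [← h] at h2
      simp only [Fin.val_castSucc, Fin.val_succ, pow_succ] at h3 h4
      have h5 := mul_pos h1 h2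
      have h6 := mul_pos h3 h4
      have e1 : ((-1 : ℝ) ^ signIndex v (J l.castSucc)) ^ 2 = 1 := by
        rw [← pow_mul, mul_comm, pow_mul]; simp
      have e2 : ((-1 : ℝ) ^ (l : ℕ)) ^ 2 = 1 := by
        rw [← pow_mul, mul_comm, pow_mul]; simp
      have h5' : 0 < v j₀ ^ 2 * (v (J l.castSucc) * v (J l.succ)) := by
        calc 0 < _ := h5
          _ = ((-1 : ℝ) ^ signIndex v (J l.castSucc)) ^ 2 *
              (v j₀ ^ 2 * (v (J l.castSucc) * v (J l.succ))) := by ring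
          _ = _ := by rw [e1, one_mul]
      have h6' : v (J l.castSucc) * v (J l.succ) < 0 := by
        have : ((-1 : ℝ) ^ (l : ℕ)) ^ 2 * (v (J l.castSucc) * v (J l.succ)) < 0 := by linarith
        rwa [e2, one_mul] at this
      have := pos_of_mul_pos_right h5' (sq_nonneg _)
      linarith
    simp only [Fin.val_castSucc, Fin.val_succ] at ih ⊢
    omega

lemma le_variation_of_alternating {v : ι → ℝ} {p : ℕ} (J : Fin (p + 1) ↪o ι)
    (hJ : ∀ l : Fin (p + 1), 0 < (-1) ^ (l : ℕ) * v (J l)) : (p : ℕ∞) ≤ variation v := by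
  obtain ⟨j₀, h₀⟩ := exists_isFirstNonzero (u := v) (i := J 0)
    (fun h => by simpa [h] using hJ 0)
  have h := le_signIndex_of_alternating h₀ J hJ (Fin.last p)
  refine le_trans ?_ (signIndex_le_variation v (J (Fin.last p)))
  rw [Fin.val_last] at h
  exact_mod_cast (by omega : p ≤ signIndex v (J (Fin.last p)))

/-- If `v` has no sign changes but those seen along `J`, its first non-zero entry has the sign of
its entry at `J 0`. -/
lemma firstNonzero_pos_of_alternating {v : ι → ℝ} {j₀ : ι} (h₀ : IsFirstNonzero v j₀) {p : ℕ}
    (J : Fin (p + 1) ↪o ι) (hJ : ∀ l : Fin (p + 1), 0 < (-1) ^ (l : ℕ) * v (J l)) (hv : variation v ≤ p) :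
    0 < v j₀ := by
  have h := le_signIndex_of_alternating h₀ J hJ (Fin.last p)
  have h1 : signIndex v (J (Fin.last p)) ≤ p := by
    exact_mod_cast (signIndex_le_variation v (J (Fin.last p))).trans hv
  have h0 : signIndex v (J 0) = 0 := by
    rw [Fin.val_last] at h
    omega
  have h2 : 0 < v (J 0) := by simpa using hJ 0
  have h3 := signIndex_sign h₀ (J 0) h2.ne'
  rw [h0, pow_zero, one_mul] at h3
  exact pos_of_mul_pos_left h3 h2.le

/-- The first non-zero entry followed by the first `p` sign changes alternates. -/
lemma exists_alternating {u : ι → ℝ} {i₀ : ι} (h₀ : IsFirstNonzero u i₀) {p : ℕ}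
    (hp : (p : ℕ∞) ≤ variation u) :
    ∃ J : Fin (p + 1) ↪o ι, ∀ l : Fin (p + 1), 0 < (-1) ^ (l : ℕ) * (u i₀ * u (J l)) := by
  classical
  rcases Nat.eq_zero_or_pos p with rfl | hp0
  · refine ⟨OrderEmbedding.ofStrictMono (fun _ => i₀) fun a b hab => by omega, fun l => ?_⟩
    rw [Fin.fin_one_eq_zero l, Fin.val_zero, pow_zero, one_mul]
    exact mul_self_pos.2 h₀.1
  rw [variation_eq_encard] at hp
  obtain ⟨T, hT, hTp⟩ := Set.exists_subset_encard_eq hp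
  have hfin : T.Finite := Set.finite_of_encard_eq_coe hTp
  have hne : hfin.toFinset.Nonempty := by
    rw [Set.Finite.toFinset_nonempty, ← Set.encard_ne_zero, hTp]
    exact_mod_cast hp0.ne'
  set m := hfin.toFinset.max' hne
  -- `T` may skip sign changes; the full initial segment makes the sign index at its `l`-th element
  -- exactly `l + 1`.
  set s := (Finset.Iic m).filter (IsSignChange u) with hs
  have hcard : p ≤ s.card := by
    have h1 : hfin.toFinset.card = p := by
      rw [hfin.encard_eq_coe_toFinset_card] at hTp
      exact_mod_cast hTp
    rw [← h1]
    apply Finset.card_le_card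
    intro t ht
    exact Finset.mem_filter.2 ⟨Finset.mem_Iic.2 (Finset.le_max' _ _ ht),
      hT (hfin.mem_toFinset.1 ht)⟩
  set e := s.orderEmbOfFin rfl
  have he : ∀ l, e l ≤ m ∧ IsSignChange u (e l) := fun l => by
    simpa only [hs, Finset.mem_filter, Finset.mem_Iic] using s.orderEmbOfFin_mem rfl l
  have hlt : ∀ l, i₀ < e l := fun l => by
    obtain ⟨r, hr, hneg, -⟩ := (he l).2
    by_contra! h
    simp [h₀.2 r (hr.trans_le h)] at hneg
  have hindex : ∀ l, signIndex u (e l) = l + 1 := fun l => by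
    have hset : (Finset.Iic (e l)).filter (IsSignChange u) =
        (Finset.Iic l).map e.toEmbedding := by
      ext t
      simp only [Finset.mem_filter, Finset.mem_Iic, Finset.mem_map, RelEmbedding.coe_toEmbedding]
      constructor
      · rintro ⟨h1, h2⟩
        have ht : t ∈ s := by
          rw [hs, Finset.mem_filter, Finset.mem_Iic]
          exact ⟨h1.trans (he l).1, h2⟩
        have hr : t ∈ Set.range e := by
          rw [Finset.range_orderEmbOfFin]
          exact ht
        obtain ⟨a, rfl⟩ := hr
        exact ⟨a, e.le_iff_le.1 h1, rfl⟩
      · rintro ⟨a, ha, rfl⟩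
        exact ⟨e.le_iff_le.2 ha, (he a).2⟩
    rw [signIndex, hset, Finset.card_map, Fin.card_Iic]
  refine ⟨OrderEmbedding.ofStrictMono (Fin.cons i₀ fun l => e (Fin.castLE hcard l)) ?_, ?_⟩
  · intro a b hab
    induction b using Fin.cases with
    | zero => exact absurd hab (Fin.not_lt_zero a)
    | succ b =>
      induction a using Fin.cases with
      | zero => simpa using hlt _
      | succ a => simpa using hab
  · intro l
    induction l using Fin.cases with
    | zero =>
      rw [Fin.val_zero, pow_zero, one_mul]
      exact mul_self_pos.2 h₀.1
    | succ l =>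
      have hnz : u (e (Fin.castLE hcard l)) ≠ 0 := fun h => by
        obtain ⟨r, -, hneg, -⟩ := (he (Fin.castLE hcard l)).2
        simp [h] at hneg
      have := signIndex_sign h₀ _ hnz
      rw [hindex] at this
      exact this

end Variation

/-! ### Nonnegative minors and merging of columns -/

/-- All minors of order at most `k` of the (possibly infinite) matrix `K` are nonnegative. -/
def MinorsNonneg {κ ι : Type*} [LinearOrder κ] [LinearOrder ι] (k : ℕ) (K : Matrix κ ι ℝ) : Prop :=
  ∀ r ≤ k, ∀ (I : Fin r ↪o κ) (J : Fin r ↪o ι), 0 ≤ (K.submatrix I J).det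

section Minors

variable {κ ι κ' ι' : Type*} [LinearOrder κ] [LinearOrder ι] [LinearOrder κ'] [LinearOrder ι']

lemma MinorsNonneg.mono {k l : ℕ} {K : Matrix κ ι ℝ} (hK : MinorsNonneg k K) (h : l ≤ k) :
    MinorsNonneg l K :=
  fun r hr => hK r (hr.trans h)

lemma MinorsNonneg.submatrix {k : ℕ} {K : Matrix κ ι ℝ} (hK : MinorsNonneg k K)
    (e : κ' ↪o κ) (f : ι' ↪o ι) : MinorsNonneg k (K.submatrix e f) :=
  fun r hr I J => hK r hr (I.trans e) (J.trans f)

/-- Nonnegativity of minors is preserved when consecutive columns are merged into nonnegative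
combinations. -/
lemma MinorsNonneg.merge {k p : ℕ} {K : Matrix κ ι ℝ} (hK : MinorsNonneg k K) (s : Finset ι)
    {β : ι → ℕ} (hβ : Monotone β) {w : ι → ℝ} (hw : ∀ i, 0 ≤ w i) :
    MinorsNonneg k (Matrix.of fun (i : κ) (j : Fin p) =>
      ∑ l ∈ s with β l = j, w l * K i l) := by
  classical
  intro r hr I J
  rw [← Matrix.det_transpose]
  have h := (Matrix.detRowAlternating (R := ℝ) (n := Fin r)).toMultilinearMap.map_sum_finset
    (fun (_ : Fin r) l => (fun a => w l * K (I a) l : Fin r → ℝ))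
    (fun b => s.filter fun l => β l = J b)
  have heq : (Matrix.submatrix (Matrix.of fun (i : κ) (j : Fin p) =>
      ∑ l ∈ s with β l = j, w l * K i l) I J).transpose =
      fun b => ∑ l ∈ s with β l = J b, (fun a => w l * K (I a) l : Fin r → ℝ) := by
    ext b a
    simp [Matrix.transpose_apply]
  rw [heq]
  refine le_of_le_of_eq (Finset.sum_nonneg fun f hf => ?_) h.symm
  rw [Fintype.mem_piFinset] at hf
  simp only [Finset.mem_filter] at hf
  -- Multilinearity picks one column from each block. Since the blocks are ordered, the picked
  -- columns increase, so each term is a nonnegative weight times a minor of `K`.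
  have hmono : StrictMono f := fun b b' hbb => by
    by_contra! hle
    have h1 := hβ hle
    rw [(hf b).2, (hf b').2] at h1
    have h2 : J b < J b' := J.strictMono hbb
    exact absurd h1 (not_le.2 h2)
  have hdet : Matrix.det (Matrix.of fun b a => w (f b) * (K.submatrix I f).transpose b a) =
      (∏ b, w (f b)) * (K.submatrix I f).transpose.det :=
    Matrix.det_mul_column (fun b => w (f b)) _
  have hnn : 0 ≤ (∏ b, w (f b)) * (K.submatrix I f).transpose.det := by
    rw [Matrix.det_transpose]
    exact mul_nonneg (Finset.prod_nonneg fun b _ => hw _)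
      (hK r hr I (OrderEmbedding.ofStrictMono f hmono))
  rw [← hdet] at hnn
  exact hnn

end Minors

/-! ### Cramer's rule and the excluded alternation -/

/-- Cramer's rule for the first unknown, expanded along the first column. -/
lemma cramer_zero_expand {p : ℕ} (M : Matrix (Fin (p + 1)) (Fin (p + 1)) ℝ)
    (x : Fin (p + 1) → ℝ) :
    M.det * x 0 = ∑ i : Fin (p + 1), (-1) ^ (i : ℕ) * (M.mulVec x) i *
      (M.submatrix i.succAbove Fin.succ).det := by
  have h : M.cramer (M.mulVec x) = M.det • x := by
    rw [Matrix.cramer_eq_adjugate_mulVec, Matrix.mulVec_mulVec, Matrix.adjugate_mul,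
      Matrix.smul_mulVec, Matrix.one_mulVec]
  have h0 := congrFun h 0
  rw [Matrix.cramer_apply, Matrix.det_succ_column_zero, Pi.smul_apply, smul_eq_mul] at h0
  rw [← h0]
  refine Finset.sum_congr rfl fun i _ => ?_
  congr 2

/-- A non-zero direction moves the all-ones vector to the boundary of the nonnegative orthant. -/
lemma exists_one_add_mul_nonneg {ι : Type*} [Fintype ι] {w : ι → ℝ} (hw : w ≠ 0) :
    ∃ c : ℝ, (∀ i, 0 ≤ 1 + c * w i) ∧ ∃ j, 1 + c * w j = 0 := by
  obtain ⟨i₁, hi₁⟩ := Function.ne_iff.1 hw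
  obtain ⟨j, -, hj⟩ := Finset.exists_max_image Finset.univ (fun i => |w i|) ⟨i₁, Finset.mem_univ _⟩
  have hj0 : 0 < |w j| := (abs_pos.2 hi₁).trans_le (hj i₁ (Finset.mem_univ _))
  have hne : w j ≠ 0 := abs_pos.1 hj0
  refine ⟨-(w j)⁻¹, fun i => ?_, j, by field_simp; ring⟩
  have h : |(w j)⁻¹ * w i| ≤ 1 := by
    rw [abs_mul, abs_inv, inv_mul_le_iff₀ hj0, mul_one]
    exact hj i (Finset.mem_univ _)
  have := (abs_le.1 h).2
  linarith

/-- A vector with at most `p` sign changes, starting with a nonnegative block, is not mapped by a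
matrix with nonnegative minors to a vector that alternates `p` times starting with a negative
entry. -/
theorem MinorsNonneg.not_alternating (p : ℕ) : ∀ {ι : Type} [LinearOrder ι]
    {K : Matrix (Fin (p + 1)) ι ℝ}, MinorsNonneg (p + 1) K → ∀ (s : Finset ι) {u : ι → ℝ}
    {β : ι → ℕ}, Monotone β → (∀ i ∈ s, β i ≤ p) → (∀ i ∈ s, 0 ≤ (-1) ^ β i * u i) →
    ¬ ∀ l : Fin (p + 1), (-1) ^ (l : ℕ) * ∑ j ∈ s, K l j * u j < 0 := by
  induction p with
  | zero =>
    intro ι _ K hK s u β _ hβp hu hneg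
    have h := hneg 0
    rw [Fin.val_zero, pow_zero, one_mul] at h
    refine absurd h (not_lt.2 (Finset.sum_nonneg fun j hj => mul_nonneg ?_ ?_))
    · have := hK 1 le_rfl (OrderEmbedding.ofStrictMono (fun _ => 0) fun a b hab => by omega)
        (OrderEmbedding.ofStrictMono (fun _ => j) fun a b hab => by omega)
      rw [Matrix.det_fin_one] at this
      exact this
    · simpa [Nat.le_zero.1 (hβp j hj)] using hu j hj
  | succ p ih =>
    intro ι _ K hK s u β hβ hβp hu hneg
    -- The weights `|u l|` absorb the sizes of the entries, so only the block signs `x` remain and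
    -- `M x = K u`.
    set M : Matrix (Fin (p + 2)) (Fin (p + 2)) ℝ :=
      Matrix.of fun i j => ∑ l ∈ s with β l = j, |u l| * K i l with hM
    have hMnn : MinorsNonneg (p + 2) M := hK.merge s hβ fun i => abs_nonneg (u i)
    set x : Fin (p + 2) → ℝ := fun j => (-1) ^ (j : ℕ) with hx
    have hMx : ∀ l, M.mulVec x l = ∑ j ∈ s, K l j * u j := fun l => by
      rw [← Finset.sum_fiberwise_of_maps_to (s := s) (t := Finset.univ)
        (g := fun i => Fin.ofNat (p + 2) (β i)) (fun _ _ => Finset.mem_univ _),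
        Matrix.mulVec, dotProduct]
      refine Finset.sum_congr rfl fun j _ => ?_
      rw [hM, Matrix.of_apply, Finset.sum_mul]
      refine Finset.sum_congr ?_ fun i hi => ?_
      · ext i
        simp only [Finset.mem_filter, and_congr_right_iff]
        intro hi
        have := hβp i hi
        rw [Fin.ext_iff, Fin.val_ofNat, Nat.mod_eq_of_lt (by omega)]
      · rw [Finset.mem_filter] at hi
        have hm : (Fin.ofNat (p + 2) (β i)) = j := hi.2
        have hb : β i = j := by
          have := hβp i hi.1
          rw [Fin.ext_iff, Fin.val_ofNat, Nat.mod_eq_of_lt (by omega)] at hm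
          exact hm
        have h1 : |u i| = (-1) ^ (j : ℕ) * u i := by
          rw [← hb, ← abs_of_nonneg (hu i hi.1), abs_mul, abs_pow]
          simp
        have h2 : ((-1 : ℝ) ^ (j : ℕ)) ^ 2 = 1 := by
          rw [← pow_mul, mul_comm, pow_mul]; simp
        rw [h1, hx]
        linear_combination (u i * K l i) * h2
    simp only [← hMx] at hneg
    have hdet : 0 ≤ M.det := by
      have := hMnn (p + 2) le_rfl (RelEmbedding.refl _) (RelEmbedding.refl _)
      exact this
    rcases hdet.eq_or_lt with h0 | hpos
    · obtain ⟨w, hw0, hw⟩ := Matrix.exists_mulVec_eq_zero_iff.2 h0.symm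
      have hsq : ∀ n : ℕ, (-1 : ℝ) ^ n * (-1) ^ n = 1 := fun n => by
        rw [← mul_pow]; simp
      -- Move from `x` along the kernel of `M` until a coordinate vanishes and no other has changed
      -- sign; the image stays the same.
      obtain ⟨c, hc, j₀, hj₀⟩ := exists_one_add_mul_nonneg
        (w := fun j : Fin (p + 2) => (-1) ^ (j : ℕ) * w j) (by
          contrapose! hw0
          ext j
          have := congrFun hw0 j
          simpa using this)
      set y : Fin (p + 2) → ℝ := x + c • w with hy
      have hMy : M.mulVec y = M.mulVec x := by
        rw [hy, Matrix.mulVec_add, Matrix.mulVec_smul, hw, smul_zero, add_zero]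
      have hynn : ∀ j : Fin (p + 2), 0 ≤ (-1) ^ (j : ℕ) * y j := fun j => by
        have := hc j
        calc (0 : ℝ) ≤ _ := this
          _ = (-1) ^ (j : ℕ) * (-1) ^ (j : ℕ) + c * ((-1) ^ (j : ℕ) * w j) := by rw [hsq]
          _ = _ := by simp only [hy, hx, Pi.add_apply, Pi.smul_apply, smul_eq_mul]; ring
      have hy0 : y j₀ = 0 := by
        have : (-1) ^ (j₀ : ℕ) * y j₀ = 0 := by
          rw [← hj₀]
          calc _ = (-1) ^ (j₀ : ℕ) * (-1) ^ (j₀ : ℕ) + c * ((-1) ^ (j₀ : ℕ) * w j₀) := by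
                simp only [hy, hx, Pi.add_apply, Pi.smul_apply, smul_eq_mul]; ring
            _ = _ := by rw [hsq]
        simpa using this
      simp only [← hMy] at hneg
      have hMsmall := hMnn.mono (Nat.le_succ (p + 1))
      by_cases hj : j₀ = 0
      -- With the first block gone, drop the first row and negate. Truncated subtraction leaves the
      -- vanished coordinate in block `0`, where it is harmless.
      · refine ih (hMsmall.submatrix (Fin.succOrderEmb (p + 1)) (RelEmbedding.refl _)) Finset.univ
          (u := -y) (β := fun j => (j : ℕ) - 1) ?_ ?_ ?_ ?_
        · intro a b hab
          have : (a : ℕ) ≤ b := hab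
          dsimp only
          omega
        · intro i _
          have := i.2
          omega
        · intro i _
          by_cases hi : i = 0
          · simp [hi, ← hj, hy0]
          · have hi' : (i : ℕ) ≠ 0 := fun h => hi (Fin.ext h)
            have h := hynn i
            obtain ⟨m, hm⟩ := Nat.exists_eq_succ_of_ne_zero hi'
            rw [hm, Nat.succ_eq_add_one, pow_succ] at h
            rw [hm, Nat.succ_eq_add_one, Nat.add_sub_cancel, Pi.neg_apply]
            linarith
        · intro l
          have h := hneg l.succ
          rw [Fin.val_succ, pow_succ, Matrix.mulVec, dotProduct] at h
          change (-1) ^ (l : ℕ) * ∑ j, M l.succ j * -y j < 0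
          simp only [mul_neg, Finset.sum_neg_distrib]
          linarith
      · have hj1 : (j₀ : ℕ) ≠ 0 := fun h => hj (Fin.ext h)
        -- The neighbours of the vanished coordinate have the same weak sign, so blocks `j₀ - 1`,
        -- `j₀`, `j₀ + 1` fuse (those that exist) and later ones shift by two, which keeps parity.
        -- The last row is dropped.
        refine ih (hMsmall.submatrix (Fin.castSuccOrderEmb) (RelEmbedding.refl _)) Finset.univ
          (u := y) (β := fun j => if j < j₀ then (j : ℕ) else if j = j₀ then j - 1 else j - 2)
          ?_ ?_ ?_ ?_
        · intro a b hab
          simp only [Fin.lt_def, Fin.ext_iff]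
          have : (a : ℕ) ≤ b := hab
          split_ifs <;> omega
        · intro i _
          have := i.2
          have := j₀.2
          simp only [Fin.lt_def, Fin.ext_iff]
          split_ifs <;> omega
        · intro i _
          have h := hynn i
          split_ifs with h1 h2
          · exact h
          · simp [h2, hy0]
          · have h3 : 2 ≤ (i : ℕ) := by
              simp only [Fin.lt_def, Fin.ext_iff] at h1 h2
              omega
            obtain ⟨m, hm⟩ := Nat.exists_eq_add_of_le' h3
            rw [hm] at h ⊢
            rw [Nat.add_sub_cancel]
            simpa [pow_add] using h
        · intro l
          exact hneg l.castSucc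
    -- Here `x 0 = 1`, while every term of the expansion is a negative number times a nonnegative
    -- minor.
    · have h := cramer_zero_expand M x
      have hx0 : x 0 = 1 := by simp [hx]
      rw [hx0, mul_one] at h
      refine absurd hpos (not_lt.2 (h ▸ Finset.sum_nonpos fun i _ => ?_))
      exact mul_nonpos_of_nonpos_of_nonneg (hneg i).le
        (hMnn (p + 1) (Nat.le_succ _) (Fin.succAboveOrderEmb i) (Fin.succOrderEmb (p + 1)))

/-! ### Variation diminution versus nonnegative minors -/

section OVD

variable {κ ι : Type} [LinearOrder κ] [LinearOrder ι] [LocallyFiniteOrderBot ι]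
  {K : Matrix κ ι ℝ}

/-- Finitely many strict inequalities survive passage to a large finite partial sum, so the finite
case applies, with the sign index as block number. The factor `u i₀` makes the first block
nonnegative. -/
lemma MinorsNonneg.not_alternating_of_hasSum {p : ℕ} (hK : MinorsNonneg (p + 1) K) {u : ι → ℝ}
    {v : κ → ℝ} (huv : ∀ i, HasSum (fun j => K i j * u j) (v i)) (hu : variation u ≤ p) {i₀ : ι}
    (h₀ : IsFirstNonzero u i₀) (J : Fin (p + 1) ↪o κ) :
    ¬ ∀ l : Fin (p + 1), (-1) ^ (l : ℕ) * (u i₀ * v (J l)) < 0 := by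
  intro hneg
  have hev : ∀ᶠ s : Finset ι in Filter.atTop, ∀ l : Fin (p + 1),
      (-1) ^ (l : ℕ) * (u i₀ * ∑ j ∈ s, K (J l) j * u j) < 0 :=
    Filter.eventually_all.2 fun l =>
      (((huv (J l)).const_mul (u i₀)).const_mul ((-1) ^ (l : ℕ))).eventually_lt_const (hneg l)
  obtain ⟨s, hs⟩ := hev.exists
  refine MinorsNonneg.not_alternating p (hK.submatrix J (RelEmbedding.refl _)) s
    (u := fun j => u i₀ * u j) (signIndex_mono u) (fun i _ => ?_) (fun i _ => ?_) fun l => ?_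
  · exact_mod_cast (signIndex_le_variation u i).trans hu
  · by_cases hi : u i = 0
    · simp [hi]
    · exact (signIndex_sign h₀ i hi).le
  · refine lt_of_eq_of_lt ?_ (hs l)
    congr 1
    rw [Finset.mul_sum]
    refine Finset.sum_congr rfl fun j _ => ?_
    simp only [Matrix.submatrix_apply, RelEmbedding.refl_apply]
    ring

/-- A vector supported on `r + 1` indices has variation at most `r`. -/
lemma variation_extend_le {r : ℕ} (J : Fin (r + 1) ↪o ι) (x : Fin (r + 1) → ℝ) :
    variation (Function.extend J x 0) ≤ r := by
  set u := Function.extend J x 0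
  by_contra! hlt
  have hlt' : ((r + 1 : ℕ) : ℕ∞) ≤ variation u := by
    push_cast
    exact Order.add_one_le_of_lt hlt
  obtain ⟨j₁, hj₁⟩ : ∃ j, u j ≠ 0 := by
    by_contra! h
    rw [variation_zero_of_forall h] at hlt
    exact not_lt_zero hlt
  obtain ⟨j₀, hj₀⟩ := exists_isFirstNonzero hj₁
  obtain ⟨J', hJ'⟩ := exists_alternating hj₀ hlt'
  have hr : ∀ l, ∃ a, J a = J' l := fun l => by
    by_contra h
    have h1 := hJ' l
    have h2 : u (J' l) = 0 := Function.extend_apply' _ _ _ h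
    simp [h2] at h1
  choose f hf using hr
  have hinj : Function.Injective f := fun a b hab => J'.injective (by rw [← hf, ← hf, hab])
  have := Fintype.card_le_of_injective f hinj
  simp at this

/-- A vector on `r + 1` indices with variation `r` has no zero entry there. -/
lemma ne_zero_of_le_variation_extend {r : ℕ} (J : Fin (r + 1) ↪o ι) {x : Fin (r + 1) → ℝ}
    (hx : x ≠ 0) (hr : (r : ℕ∞) ≤ variation (Function.extend J x 0)) (b : Fin (r + 1)) :
    x b ≠ 0 := by
  set u := Function.extend J x 0
  have hJx : ∀ a, u (J a) = x a := fun a => J.injective.extend_apply _ _ _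
  obtain ⟨a, ha⟩ := Function.ne_iff.1 hx
  obtain ⟨j₀, hj₀⟩ := exists_isFirstNonzero (u := u) (i := J a) (by rwa [hJx])
  obtain ⟨J', hJ'⟩ := exists_alternating hj₀ hr
  have hne : ∀ l, u (J' l) ≠ 0 := fun l h => by simpa [h] using hJ' l
  have hr : ∀ l, ∃ a, J a = J' l := fun l => by
    by_contra h
    exact hne l (Function.extend_apply' _ _ _ h)
  choose f hf using hr
  have hinj : Function.Injective f := fun a b hab => J'.injective (by rw [← hf, ← hf, hab])
  obtain ⟨l, rfl⟩ := (Finite.injective_iff_surjective.1 hinj) b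
  rw [← hJx, hf]
  exact hne l

variable [LocallyFiniteOrderBot κ]

/-- A matrix with nonnegative minors of order at most `k` is `OVD_{k - 1}`. -/
theorem MinorsNonneg.isOVD {k : ℕ} (hk : 1 ≤ k) (hK : MinorsNonneg k K) {D : Set (ι → ℝ)}
    {X : (ι → ℝ) → (κ → ℝ)} (hX : ∀ u ∈ D, ∀ i, HasSum (fun j => K i j * u j) (X u i)) :
    IsOVD (k - 1) D X := by
  intro u huD hu
  have huv := hX u huD
  set v := X u
  by_cases hne : ∃ i, u i ≠ 0
  swap
  · push Not at hne
    have hv : ∀ i, v i = 0 := fun i => (huv i).unique (by simp [hne])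
    rw [variation_zero_of_forall hv]
    exact ⟨zero_le, fun _ i j hi => absurd (hne i) hi.1⟩
  obtain ⟨i₁, hi₁⟩ := hne
  obtain ⟨i₀, h₀⟩ := exists_isFirstNonzero hi₁
  obtain ⟨p, hp⟩ := ENat.ne_top_iff_exists.1 (ne_top_of_le_ne_top (ENat.natCast_ne_top _) hu)
  rw [← hp] at hu ⊢
  have hpk : p + 1 ≤ k := by
    have : p ≤ k - 1 := by exact_mod_cast hu
    omega
  have hno := fun J => (hK.mono hpk).not_alternating_of_hasSum huv hp.ge h₀ J
  have hsign : ∀ j₀, IsFirstNonzero v j₀ → (p : ℕ∞) ≤ variation v → 0 < u i₀ * v j₀ := by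
    intro j₀ hj₀ hle
    by_contra! hcon
    have hcon' := lt_of_le_of_ne hcon (mul_ne_zero h₀.1 hj₀.1)
    obtain ⟨J, hJ⟩ := exists_alternating hj₀ hle
    refine hno J fun l => ?_
    have := mul_neg_of_pos_of_neg (hJ l) hcon'
    have hsq : 0 < v j₀ ^ 2 := by have := hj₀.1; positivity
    refine neg_of_mul_neg_left (b := v j₀ ^ 2) ?_ hsq.le
    linarith
  refine ⟨?_, fun heq i j hi hj => ?_⟩
  · by_contra! hlt
    have hlt' : ((p + 1 : ℕ) : ℕ∞) ≤ variation v := by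
      push_cast
      exact Order.add_one_le_of_lt hlt
    obtain ⟨j₁, hj₁⟩ : ∃ j, v j ≠ 0 := by
      by_contra! h
      rw [variation_zero_of_forall h] at hlt
      exact not_lt_zero hlt
    obtain ⟨j₀, hj₀⟩ := exists_isFirstNonzero hj₁
    have hpos := hsign j₀ hj₀ hlt.le
    obtain ⟨J, hJ⟩ := exists_alternating hj₀ hlt'
    -- Without its first entry, the alternation of length `p + 2` starts with the wrong sign.
    refine hno ((Fin.succOrderEmb (p + 1)).trans J) fun l => ?_
    have h := mul_pos (hJ l.succ) hpos
    rw [Fin.val_succ, pow_succ] at h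
    have hsq : 0 < v j₀ ^ 2 := by have := hj₀.1; positivity
    refine neg_of_mul_neg_left (b := v j₀ ^ 2) ?_ hsq.le
    change (-1) ^ (l : ℕ) * (u i₀ * v (J l.succ)) * v j₀ ^ 2 < 0
    linarith
  · have hii : i = i₀ := by
      rcases lt_trichotomy i i₀ with h | h | h
      · exact absurd (h₀.2 i h) hi.1
      · exact h
      · exact absurd (hi.2 i₀ h) h₀.1
    subst hii
    have h := hsign j hj heq.ge
    rcases lt_or_gt_of_ne h₀.1 with h1 | h1
    · rw [sign_neg h1, sign_neg (by nlinarith)]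
    · rw [sign_pos h1, sign_pos (pos_of_mul_pos_right h h1.le)]

/-- An `OVD_{k - 1}` map given by a matrix has nonnegative minors of order at most `k`. -/
theorem IsOVD.minorsNonneg {k : ℕ} {D : Set (ι → ℝ)}
    (hD : ∀ u : ι → ℝ, (Function.support u).Finite → u ∈ D) {X : (ι → ℝ) → (κ → ℝ)}
    (hX : ∀ u ∈ D, ∀ i, HasSum (fun j => K i j * u j) (X u i)) (h : IsOVD (k - 1) D X) :
    MinorsNonneg k K := by
  intro r
  induction r with
  | zero => intro _ I J; simp
  | succ r ih =>
    intro hr I J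
    by_contra! hdet
    set M := K.submatrix I J with hM
    -- The test vector: supported on `r + 1` indices, its image attains the largest variation `r`
    -- that its own variation can have.
    set x : Fin (r + 1) → ℝ := M⁻¹.mulVec (fun a => (-1) ^ (a : ℕ)) with hx
    have hMx : M.mulVec x = fun a : Fin (r + 1) => (-1) ^ (a : ℕ) := by
      rw [hx, Matrix.mulVec_mulVec, Matrix.mul_nonsing_inv _ (isUnit_iff_ne_zero.2 hdet.ne),
        Matrix.one_mulVec]
    set u := Function.extend J x 0 with hu
    have hJx : ∀ a, u (J a) = x a := fun a => J.injective.extend_apply _ _ _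
    have hout : ∀ j, (¬ ∃ a, J a = j) → u j = 0 := fun j hj => Function.extend_apply' _ _ _ hj
    have huD : u ∈ D := hD u <| (Set.finite_range J).subset fun j hj => by
      by_contra hr
      exact hj (hout j hr)
    have hXu : ∀ a, X u (I a) = (-1) ^ (a : ℕ) := fun a => by
      have h1 : HasSum (fun j => K (I a) j * u j)
          (∑ j ∈ Finset.univ.map J.toEmbedding, K (I a) j * u j) :=
        hasSum_sum_of_ne_finset_zero fun j hj => by
          rw [hout j (by simpa using hj), mul_zero]
      rw [(hX u huD (I a)).unique h1, Finset.sum_map]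
      simp only [RelEmbedding.coe_toEmbedding, hJx]
      exact congrFun hMx a
    have hvu : variation u ≤ r := variation_extend_le J x
    obtain ⟨hle, hsign⟩ := h u huD (hvu.trans (by exact_mod_cast (by omega : r ≤ k - 1)))
    have halt : ∀ l : Fin (r + 1), 0 < (-1) ^ (l : ℕ) * X u (I l) := fun l => by
      rw [hXu, ← mul_pow]
      simp
    have hge := le_variation_of_alternating I halt
    have hx0 : x ≠ 0 := fun h0 => by
      have := congrFun hMx 0
      simp [h0] at this
    -- The OVD bound forces variation `r` on `x` too, so `x 0` is non-zero and is the leading entry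
    -- of `u`.
    have hxne := ne_zero_of_le_variation_extend J hx0 (hge.trans hle) 0
    have hfirst : IsFirstNonzero u (J 0) := by
      refine ⟨by rwa [hJx], fun l hl => hout l ?_⟩
      rintro ⟨a, rfl⟩
      exact Fin.not_lt_zero a (J.lt_iff_lt.1 hl)
    obtain ⟨j₀, hj₀⟩ := exists_isFirstNonzero (u := X u) (i := I 0) (by simp [hXu])
    have hpos := firstNonzero_pos_of_alternating hj₀ I halt (hle.trans hvu)
    have hs := hsign (le_antisymm hle (hvu.trans hge)) _ _ hfirst hj₀
    rw [sign_pos hpos, sign_eq_one_iff, hJx] at hs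
    have hcr := cramer_zero_expand M x
    refine absurd (mul_neg_of_neg_of_pos hdet hs) (not_lt.2 (hcr ▸ Finset.sum_nonneg fun i _ => ?_))
    rw [hMx]
    refine mul_nonneg (by rw [← mul_pow]; simp) ?_
    exact ih (by omega) ((Fin.succAboveOrderEmb i).trans I) ((Fin.succOrderEmb r).trans J)

end OVD

/-! ### Controllability and observability operators -/

section Systems

variable {n : ℕ}

lemma isKPositive_iff_minorsNonneg {m : ℕ} (k : ℕ) (X : Matrix (Fin m) (Fin n) ℝ) :
    IsKPositive k X ↔ MinorsNonneg k X := by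
  constructor
  · intro h r hr I J
    rcases Nat.eq_zero_or_pos r with rfl | h0
    · simp
    · exact h r h0 hr I J
  · intro h r _ hr I J
    exact h r hr I J

/-- An order embedding of `Fin r` into `ℕ` factors through `Fin t` for large `t`. -/
lemma exists_factor_fin {r : ℕ} (J : Fin r ↪o ℕ) (k : ℕ) :
    ∃ t, k ≤ t ∧ ∃ J' : Fin r ↪o Fin t, ∀ a, (J' a : ℕ) = J a := by
  -- The sum exceeds each `J a`, and the summand `k` meets the requirement `k ≤ t`.
  refine ⟨k + (∑ a, J a + 1), by omega, OrderEmbedding.ofStrictMono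
    (fun a => ⟨J a, ?_⟩) fun a b hab => J.strictMono hab, fun a => rfl⟩
  have := Finset.single_le_sum (f := fun a => J a) (fun _ _ => Nat.zero_le _) (Finset.mem_univ a)
  omega

/-- The infinite controllability matrix `(b  A b  A ^ 2 b  …)`. -/
noncomputable def conKernel (A : Matrix (Fin n) (Fin n) ℝ) (b : Fin n → ℝ) :
    Matrix (Fin n) ℕ ℝ :=
  Matrix.of fun i τ => (A ^ τ).mulVec b i

lemma minorsNonneg_conKernel_iff (k : ℕ) (A : Matrix (Fin n) (Fin n) ℝ) (b : Fin n → ℝ) :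
    MinorsNonneg k (conKernel A b) ↔ ∀ t, k ≤ t → IsKPositive k (conMatrix A b t) := by
  simp only [isKPositive_iff_minorsNonneg]
  constructor
  · intro h t _
    exact h.submatrix (RelEmbedding.refl _) (Fin.valOrderEmb t)
  · intro h r hr I J
    obtain ⟨t, ht, J', hJ'⟩ := exists_factor_fin J k
    have := h t ht r hr I J'
    simpa [conMatrix, conKernel, Matrix.submatrix, hJ'] using this

lemma minorsNonneg_obsKernel_iff (k : ℕ) (A : Matrix (Fin n) (Fin n) ℝ) (c : Fin n → ℝ) :
    MinorsNonneg k (conKernel A.transpose c).transpose ↔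
      ∀ t, k ≤ t → IsKPositive k (obsMatrix A c t) := by
  simp only [isKPositive_iff_minorsNonneg]
  constructor
  · intro h t _
    exact h.submatrix (Fin.valOrderEmb t) (RelEmbedding.refl _)
  · intro h r hr I J
    obtain ⟨t, ht, I', hI'⟩ := exists_factor_fin I k
    have := h t ht r hr I' J
    simpa [obsMatrix, conMatrix, conKernel, Matrix.submatrix, Matrix.transpose, hI'] using this

/-- The test vectors behind `IsOVD.minorsNonneg` have finite support, so they are admissible inputs.
-/
lemma mem_pastInputs_of_finite_support {u : ℕ → ℝ} (hu : (Function.support u).Finite) :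
    u ∈ pastInputs := by
  have h : Memℓp u 0 := memℓp_zero hu
  exact (h.of_exponent_ge zero_le : Memℓp u ⊤)

lemma hasSum_conOp {A : Matrix (Fin n) (Fin n) ℝ} (hA : IsStable A) (b : Fin n → ℝ) {u : ℕ → ℝ}
    (hu : u ∈ pastInputs) (i : Fin n) :
    HasSum (fun τ => conKernel A b i τ * u τ) (conOp A b u i) := by
  have h := Pi.hasSum.1 (summable_conOp hA b hu).hasSum i
  simp only [Pi.smul_apply, smul_eq_mul] at h
  simp only [conKernel, Matrix.of_apply, mul_comm]
  exact h

/-- Duality: the row `c A ^ t` is the column `(Aᵀ) ^ t cᵀ` of the transposed system. -/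
lemma hasSum_obsOp (A : Matrix (Fin n) (Fin n) ℝ) (c x₀ : Fin n → ℝ) (t : ℕ) :
    HasSum (fun j => (conKernel A.transpose c).transpose t j * x₀ j) (obsOp A c x₀ t) := by
  have h : obsOp A c x₀ t = ∑ j, (conKernel A.transpose c).transpose t j * x₀ j := by
    rw [obsOp, Matrix.dotProduct_mulVec, ← Matrix.mulVec_transpose, Matrix.transpose_pow]
    rfl
  rw [h]
  exact hasSum_fintype _

theorem isOVD_mulVec_iff {k : ℕ} (hk : 1 ≤ k) (A : Matrix (Fin n) (Fin n) ℝ) :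
    IsOVD (k - 1) Set.univ A.mulVec ↔ IsKPositive k A := by
  have hX : ∀ u ∈ Set.univ, ∀ i, HasSum (fun j => A i j * u j) (A.mulVec u i) :=
    fun u _ i => hasSum_fintype _
  rw [isKPositive_iff_minorsNonneg]
  exact ⟨IsOVD.minorsNonneg (fun _ _ => Set.mem_univ _) hX, fun h => h.isOVD hk hX⟩

theorem isOVD_conOp_iff {k : ℕ} (hk : 1 ≤ k) {A : Matrix (Fin n) (Fin n) ℝ} (hA : IsStable A)
    (b : Fin n → ℝ) :
    IsOVD (k - 1) pastInputs (conOp A b) ↔ ∀ t, k ≤ t → IsKPositive k (conMatrix A b t) := by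
  rw [← minorsNonneg_conKernel_iff]
  exact ⟨IsOVD.minorsNonneg (fun _ => mem_pastInputs_of_finite_support)
    (fun _ hu => hasSum_conOp hA b hu), fun h => h.isOVD hk fun _ hu => hasSum_conOp hA b hu⟩

theorem isOVD_obsOp_iff {k : ℕ} (hk : 1 ≤ k) (A : Matrix (Fin n) (Fin n) ℝ) (c : Fin n → ℝ) :
    IsOVD (k - 1) Set.univ (obsOp A c) ↔ ∀ t, k ≤ t → IsKPositive k (obsMatrix A c t) := by
  rw [← minorsNonneg_obsKernel_iff]
  exact ⟨IsOVD.minorsNonneg (fun _ _ => Set.mem_univ _) (fun u _ => hasSum_obsOp A c u),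
    fun h => h.isOVD hk fun u _ => hasSum_obsOp A c u⟩

end Systems

end HankelPositivity

open HankelPositivity in
theorem mainTheorem12 {n : ℕ} (k : ℕ) (hk : 1 ≤ k)
    (A : Matrix (Fin n) (Fin n) ℝ) (hA : IsStable A) (b c : Fin n → ℝ) :
    (IsOVD (k - 1) pastInputs (conOp A b) ↔ ∀ t, k ≤ t → IsKPositive k (conMatrix A b t)) ∧
    (IsOVD (k - 1) Set.univ (obsOp A c) ↔ ∀ t, k ≤ t → IsKPositive k (obsMatrix A c t)) ∧
    (IsInternallyHankelPositive k A b c ↔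
      IsKPositive k A ∧
        ∀ t, k ≤ t → IsKPositive k (conMatrix A b t) ∧ IsKPositive k (obsMatrix A c t)) := by
  refine ⟨isOVD_conOp_iff hk hA b, isOVD_obsOp_iff hk A c, ?_⟩
  rw [IsInternallyHankelPositive, isOVD_mulVec_iff hk, isOVD_conOp_iff hk hA, isOVD_obsOp_iff hk]
  simp only [← forall_and]
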